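/- Let $N\ge 1$, let $\|\cdot\|_a$ and $\|\cdot\|_b$ be norms on $\mathbb{R}^N$ that are monotone, i.e. $0\le y\le x$ (entrywise) implies $\|y\|\le\|x\|$, and let $T=(t_1,\dots,t_N):\mathbb{R}_+^N\to\mathbb{R}_{++}^N$ be continuous and concave (entrywise), where $\mathbb{R}_+$ and $\mathbb{R}_{++}$ denote the nonnegative and the positive reals. For every power budget $\bar p>0$ consider the problem of maximizing $c$ over all $(p,c)\in\mathbb{R}_+^N\times\mathbb{R}_{++}$ with $p=cT(p)$ and $\|p\|_a\le\bar p$. This problem has a unique solution, denoted by $(P(\bar p),U(\bar p))$. The $\|\cdot\|_b$-energy efficiency function is $E:\mathbb{R}_{++}\to\mathbb{R}_{++}$, $E(\bar p)=U(\bar p)/\|P(\bar p)\|_b$. Let $M\in\mathbb{R}_+^{N\times N}$ be the lower bounding matrix of $T$, with entries $M_{ij}=\lim_{h\to0^+}h\,t_i(h^{-1}e_j)$, where $e_j$ is the $j$th standard unit vector; these limits exist and are finite and nonnegative. Let $\rho(M)$ be the spectral radius of $M$. Then: (i) The limit $\lim_{\bar p\to\infty}E(\bar p)$ exists and $\inf_{\bar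 p>0}E(\bar p)=\lim_{\bar p\to\infty}E(\bar p)<\infty$. Furthermore, if $\rho(M)>0$, then $\lim_{\bar p\to\infty}E(\bar p)=0$. (ii) If $\rho(M)>0$, then there are $k_1>0$ and $k_2>0$ such that $\dfrac{1}{k_1\bar p+k_2}\le E(\bar p)$ for every $\bar p>0$. (iii) If $\rho(M)>0$, then $E(\bar p)\in\Theta(1/\bar p)$ as $\bar p\to\infty$, i.e. there are $k_0,k_1,k_2>0$ such that $k_1/\bar p\le E(\bar p)\le k_2/\bar p$ for every $\bar p\ge k_0$. -/

import Mathlib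

open Filter Topology

namespace NetUtility

/-- A monotone norm on `ℝ^N`: a norm (a seminorm that vanishes only at `0`) that is monotone
on the nonnegative orthant. -/
structure IsMonotoneNorm {N : ℕ} (n : Seminorm ℝ (Fin N → ℝ)) : Prop where
  definite : ∀ x, n x = 0 → x = 0
  mono : ∀ x y, 0 ≤ y → y ≤ x → n y ≤ n x

/-- A continuous concave mapping `T : ℝ₊^N → ℝ₊₊^N`. Only the values of `T` on the nonnegative
orthant `Set.Ici 0` matter; the order on vectors is entrywise. -/
structure IsInterferenceMapping {N : ℕ} (T : (Fin N → ℝ) → (Fin N → ℝ)) : Prop where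
  continuousOn : ContinuousOn T (Set.Ici 0)
  concaveOn : ConcaveOn ℝ (Set.Ici 0) T
  pos : ∀ p, 0 ≤ p → ∀ i, 0 < T p i

/-- `s = (p, c)` satisfies the constraints of the canonical problem with power budget `pbar`:
`p ∈ Fix(cT)`, `‖p‖ₐ ≤ pbar`, `p ∈ ℝ₊^N`, `c > 0`. -/
structure IsFeasible {N : ℕ} (T : (Fin N → ℝ) → (Fin N → ℝ)) (a : Seminorm ℝ (Fin N → ℝ))
    (pbar : ℝ) (s : (Fin N → ℝ) × ℝ) : Prop where
  nonneg : 0 ≤ s.1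
  pos : 0 < s.2
  fixed : s.1 = s.2 • T s.1
  budget : a s.1 ≤ pbar

/-- `s = (p, c)` solves the canonical problem: it is feasible and `c` is maximal among all
feasible tuples. -/
structure IsOptimal {N : ℕ} (T : (Fin N → ℝ) → (Fin N → ℝ)) (a : Seminorm ℝ (Fin N → ℝ))
    (pbar : ℝ) (s : (Fin N → ℝ) × ℝ) : Prop where
  feasible : IsFeasible T a pbar s
  maximal : ∀ s', IsFeasible T a pbar s' → s'.2 ≤ s.2

/-- The solution of the canonical problem with power budget `pbar` (an arbitrary tuple if there
is no solution). -/
noncomputable def solution {N : ℕ} (T : (Fin N → ℝ) → (Fin N → ℝ))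
    (a : Seminorm ℝ (Fin N → ℝ)) (pbar : ℝ) : (Fin N → ℝ) × ℝ :=
  Classical.epsilon (IsOptimal T a pbar)

/-- The power function `P`. -/
noncomputable def power {N : ℕ} (T : (Fin N → ℝ) → (Fin N → ℝ))
    (a : Seminorm ℝ (Fin N → ℝ)) (pbar : ℝ) : Fin N → ℝ :=
  (solution T a pbar).1

/-- The utility function `U`. -/
noncomputable def utility {N : ℕ} (T : (Fin N → ℝ) → (Fin N → ℝ))
    (a : Seminorm ℝ (Fin N → ℝ)) (pbar : ℝ) : ℝ :=
  (solution T a pbar).2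

/-- The `‖·‖_b`-energy efficiency function `E(pbar) = U(pbar) / ‖P(pbar)‖_b`. -/
noncomputable def energyEfficiency {N : ℕ} (T : (Fin N → ℝ) → (Fin N → ℝ))
    (a b : Seminorm ℝ (Fin N → ℝ)) (pbar : ℝ) : ℝ :=
  utility T a pbar / b (power T a pbar)

/-- The lower bounding matrix of `T`: its `(i, j)` entry is the limit of `h * tᵢ(h⁻¹ eⱼ)` as
`h → 0⁺`. -/
noncomputable def lowerBoundingMatrix {N : ℕ} (T : (Fin N → ℝ) → (Fin N → ℝ)) :
    Matrix (Fin N) (Fin N) ℝ :=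
  Matrix.of fun i j =>
    limUnder (𝓝[>] (0 : ℝ)) fun h : ℝ => h * T (h⁻¹ • Pi.single j (1 : ℝ)) i

/-- The spectral radius of a real matrix: the largest modulus of a complex eigenvalue. -/
noncomputable def rho {N : ℕ} (M : Matrix (Fin N) (Fin N) ℝ) : ENNReal :=
  spectralRadius ℂ (M.map (fun x : ℝ => (x : ℂ)))

/-- `f(x) ∈ Θ(g(x))` as `x → ∞`. -/
def ScalesAsTheta (f g : ℝ → ℝ) : Prop :=
  ∃ k₀ k₁ k₂ : ℝ, 0 < k₀ ∧ 0 < k₁ ∧ 0 < k₂ ∧ ∀ x : ℝ, k₀ ≤ x → k₁ * g x ≤ f x ∧ f x ≤ k₂ * g x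

end NetUtility

namespace NetUtility

/-! ### Monotonicity, scalability and fixed points of positive concave maps -/

section Interference

variable {N : ℕ} {T : (Fin N → ℝ) → (Fin N → ℝ)}

/-! Since `P = U T(P)`, the factor `U` cancels and `E = 1 / ‖T(P)‖_b`. A positive concave map on the
orthant is monotone and strictly subhomogeneous (`T (t x) < t T x` for `t > 1`). This yields a
comparison principle, hence uniqueness of the optimum and growth of `P` with the budget; so `E`
decreases and its limit is its infimum. Subhomogeneity makes `‖T(P)‖_b` grow at most affinely in the
budget, which is the lower bound.

For the upper bound, concavity gives `M p ≤ T p`, so `M P ≤ U⁻¹ P` with `P` positive. By a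
Collatz–Wielandt argument every eigenvalue of `M` has modulus at most `U⁻¹`, so a nonzero one bounds
`U`. As the budget is exhausted, `‖P‖_b` is at least a multiple of it, and `E = O(1 / pbar)`. -/

theorem IsInterferenceMapping.mono (hT : IsInterferenceMapping T) {x y : Fin N → ℝ}
    (hx : 0 ≤ x) (hxy : x ≤ y) : T x ≤ T y := by
  intro i
  by_contra! hlt
  have hxi := hT.pos x hx i
  have hyi := hT.pos y (hx.trans hxy) i
  -- Chosen so that `(1 - s) * T x i = T y i`. With `z` on the ray from `x` through `y`, concavity
  -- then gives `T y i ≥ T y i + s * T z i`, against positivity at `z`.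
  obtain ⟨s, hs⟩ : ∃ s, s = (T x i - T y i) / T x i := ⟨_, rfl⟩
  have hs0 : 0 < s := hs ▸ div_pos (sub_pos.2 hlt) hxi
  have hs1 : s ≤ 1 := by rw [hs, div_le_one hxi]; linarith
  have hsx : s * T x i = T x i - T y i := by rw [hs]; field_simp
  have hz : 0 ≤ x + s⁻¹ • (y - x) :=
    add_nonneg hx (smul_nonneg (inv_nonneg.2 hs0.le) (sub_nonneg.2 hxy))
  have hconc := hT.concaveOn.2 (x := x) (y := x + s⁻¹ • (y - x)) hx hz
    (sub_nonneg.2 hs1) hs0.le (by ring) i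
  have hcomb : (1 - s) • x + s • (x + s⁻¹ • (y - x)) = y := by
    ext j
    simp only [Pi.add_apply, Pi.smul_apply, Pi.sub_apply, smul_eq_mul]
    field_simp
    ring
  rw [hcomb] at hconc
  simp only [Pi.add_apply, Pi.smul_apply, smul_eq_mul] at hconc
  have := mul_pos hs0 (hT.pos _ hz i)
  linarith

/-- Concavity between `t • x` and the origin; strictness comes from `T 0 > 0`. -/
theorem IsInterferenceMapping.apply_smul_lt (hT : IsInterferenceMapping T) {x : Fin N → ℝ}
    (hx : 0 ≤ x) {t : ℝ} (ht : 1 < t) (i : Fin N) : T (t • x) i < t * T x i := by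
  have ht0 : 0 < t := one_pos.trans ht
  have hconc := hT.concaveOn.2 (x := t • x) (y := 0) (smul_nonneg ht0.le hx)
    (le_refl (0 : Fin N → ℝ)) (inv_nonneg.2 ht0.le)
    (sub_nonneg.2 (inv_le_one_of_one_le₀ ht.le)) (by ring) i
  rw [smul_zero, add_zero, smul_smul, inv_mul_cancel₀ ht0.ne', one_smul] at hconc
  simp only [Pi.add_apply, Pi.smul_apply, smul_eq_mul] at hconc
  have h0 : 0 < (1 - t⁻¹) * T 0 i :=
    mul_pos (sub_pos.2 (inv_lt_one_of_one_lt₀ ht)) (hT.pos 0 le_rfl i)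
  have h1 : t⁻¹ * T (t • x) i < T x i := by linarith
  rwa [inv_mul_lt_iff₀ ht0] at h1

theorem IsInterferenceMapping.apply_smul_le (hT : IsInterferenceMapping T) {x : Fin N → ℝ}
    (hx : 0 ≤ x) {t : ℝ} (ht : 1 ≤ t) : T (t • x) ≤ t • T x := by
  intro i
  rcases ht.eq_or_lt with rfl | ht
  · simp
  · exact (hT.apply_smul_lt hx ht i).le

/-- The largest entrywise ratio of a vector to a positive vector is attained. -/
theorem exists_max_ratio (hN : 0 < N) (p : Fin N → ℝ) {q : Fin N → ℝ} (hq : ∀ i, 0 < q i) :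
    ∃ (t : ℝ) (i : Fin N), p i = t * q i ∧ p ≤ t • q := by
  have : Nonempty (Fin N) := ⟨⟨0, hN⟩⟩
  obtain ⟨i, hi⟩ := Finite.exists_max fun i => p i / q i
  refine ⟨p i / q i, i, (div_mul_cancel₀ _ (hq i).ne').symm, fun j => ?_⟩
  have := hi j
  rwa [div_le_iff₀ (hq j)] at this

/-- Every subsolution of `p = c T(p)` lies below every supersolution. -/
theorem IsInterferenceMapping.le_of_subsolution (hT : IsInterferenceMapping T)
    {p q : Fin N → ℝ} {c : ℝ} (hc : 0 < c) (hp0 : 0 ≤ p) (hq0 : 0 ≤ q)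
    (hp : p ≤ c • T p) (hq : c • T q ≤ q) : p ≤ q := by
  rcases Nat.eq_zero_or_pos N with rfl | hN
  · exact fun i => i.elim0
  have hqpos : ∀ i, 0 < q i := fun i => (mul_pos hc (hT.pos q hq0 i)).trans_le (hq i)
  obtain ⟨t, i, hti, htp⟩ := exists_max_ratio hN p hqpos
  rcases le_or_gt t 1 with ht | ht
  · intro j
    have := htp j
    simp only [Pi.smul_apply, smul_eq_mul] at this
    nlinarith [hqpos j]
  -- At the coordinate where `p = t q`, subhomogeneity gives `p i ≤ c T(t q) i < t c T(q) i ≤ t q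
  -- i`.
  · exfalso
    have h1 : p i ≤ c * T p i := hp i
    have h2 : T p i ≤ T (t • q) i := hT.mono hp0 htp i
    have h3 := hT.apply_smul_lt hq0 ht i
    have h4 : c * T q i ≤ q i := hq i
    have h5 : c * T p i < c * (t * T q i) := mul_lt_mul_of_pos_left (h2.trans_lt h3) hc
    have h6 : t * (c * T q i) ≤ t * q i := mul_le_mul_of_nonneg_left h4 (by linarith)
    linarith

/-- There is a solution of `p = c T(p)` below every supersolution. -/
theorem IsInterferenceMapping.exists_fixed_le (hT : IsInterferenceMapping T)
    {q : Fin N → ℝ} {c : ℝ} (hc : 0 < c) (hq0 : 0 ≤ q) (hq : c • T q ≤ q) :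
    ∃ p, 0 ≤ p ∧ p ≤ q ∧ p = c • T p := by
  -- Iterates from `0` increase and stay below `q`; continuity makes their limit a fixed point.
  obtain ⟨u, hu⟩ : ∃ u : ℕ → Fin N → ℝ, u = fun n => (fun p => c • T p)^[n] 0 := ⟨_, rfl⟩
  have hu0 : u 0 = 0 := by simp [hu]
  have hus : ∀ n, u (n + 1) = c • T (u n) := fun n => by
    simp only [hu, Function.iterate_succ_apply']
  have hnonneg : ∀ n, 0 ≤ u n := by
    intro n
    induction n with
    | zero => exact hu0.ge
    | succ n ih => rw [hus]; exact smul_nonneg hc.le fun i => (hT.pos _ ih i).le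
  have hmono : Monotone u := by
    refine monotone_nat_of_le_succ fun n => ?_
    induction n with
    | zero => rw [hu0]; exact hnonneg 1
    | succ n ih =>
      rw [hus n, hus (n + 1)]
      exact smul_le_smul_of_nonneg_left (hT.mono (hnonneg n) ih) hc.le
  have hle : ∀ n, u n ≤ q := by
    intro n
    induction n with
    | zero => rw [hu0]; exact hq0
    | succ n ih =>
      rw [hus]
      exact (smul_le_smul_of_nonneg_left (hT.mono (hnonneg n) ih) hc.le).trans hq
  have hlim : Tendsto u atTop (𝓝 fun i => ⨆ n, u n i) := by
    refine tendsto_pi_nhds.2 fun i => tendsto_atTop_ciSup (fun m n h => hmono h i) ⟨q i, ?_⟩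
    rintro _ ⟨n, rfl⟩
    exact hle n i
  obtain ⟨p, hp⟩ : ∃ p, Tendsto u atTop (𝓝 p) := ⟨_, hlim⟩
  have hp0 : 0 ≤ p := ge_of_tendsto' hp hnonneg
  refine ⟨p, hp0, le_of_tendsto' hp hle, ?_⟩
  have hTp : Tendsto (fun n => T (u n)) atTop (𝓝 (T p)) :=
    (hT.continuousOn p hp0).tendsto.comp
      (tendsto_nhdsWithin_iff.2 ⟨hp, Eventually.of_forall hnonneg⟩)
  refine tendsto_nhds_unique (hp.comp (tendsto_add_atTop_nat 1)) ?_
  have : (u ∘ fun n => n + 1) = fun n => c • T (u n) := funext hus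
  rw [this]
  exact hTp.const_smul c

end Interference

/-! ### Comparison of monotone norms on the orthant -/

section Norms

variable {N : ℕ}

theorem continuous_seminorm (n : Seminorm ℝ (Fin N → ℝ)) : Continuous n :=
  continuousOn_univ.1 (n.convexOn.continuousOn isOpen_univ)

theorem IsMonotoneNorm.pos {n : Seminorm ℝ (Fin N → ℝ)} (hn : IsMonotoneNorm n)
    {x : Fin N → ℝ} (hx : x ≠ 0) : 0 < n x :=
  (apply_nonneg n x).lt_of_ne fun h => hx (hn.definite x h.symm)

theorem IsMonotoneNorm.abs_apply_le {n : Seminorm ℝ (Fin N → ℝ)} (hn : IsMonotoneNorm n) :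
    ∃ C, 0 < C ∧ ∀ x : Fin N → ℝ, 0 ≤ x → ∀ i, x i ≤ C * n x := by
  have hpos : ∀ i : Fin N, 0 < n (Pi.single i 1) := fun i => hn.pos (by simp)
  refine ⟨1 + ∑ i, (n (Pi.single i 1))⁻¹, ?_, fun x hx i => ?_⟩
  · have := Finset.sum_nonneg fun i (_ : i ∈ Finset.univ) => (inv_pos.2 (hpos i)).le
    linarith
  · have h1 : n (x i • Pi.single i 1) ≤ n x := by
      refine hn.mono _ _ (smul_nonneg (hx i) (Pi.single_nonneg.2 zero_le_one)) fun j => ?_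
      rcases eq_or_ne j i with rfl | hj
      · simp
      · simpa [hj] using hx j
    rw [map_smul_eq_mul, Real.norm_of_nonneg (hx i), ← le_div_iff₀ (hpos i)] at h1
    have h2 := Finset.single_le_sum (fun i _ => (inv_pos.2 (hpos i)).le) (Finset.mem_univ i)
    have h3 := mul_le_mul_of_nonneg_right h2 (apply_nonneg n x)
    have h4 := apply_nonneg n x
    rw [div_eq_inv_mul] at h1
    linarith

theorem IsMonotoneNorm.le_mul {m n : Seminorm ℝ (Fin N → ℝ)} (hm : IsMonotoneNorm m)
    (hn : IsMonotoneNorm n) : ∃ C, 0 < C ∧ ∀ x : Fin N → ℝ, 0 ≤ x → m x ≤ C * n x := by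
  obtain ⟨C, hC, h⟩ := hn.abs_apply_le
  have h1 : 0 ≤ m 1 := apply_nonneg m 1
  refine ⟨C * m 1 + 1, by positivity, fun x hx => ?_⟩
  have h2 : m x ≤ m ((C * n x) • (1 : Fin N → ℝ)) :=
    hm.mono _ _ hx fun i => by simpa using h x hx i
  have h0 := apply_nonneg n x
  rw [map_smul_eq_mul, Real.norm_of_nonneg (by positivity)] at h2
  nlinarith

end Norms

/-! ### The canonical problem and monotonicity of the energy efficiency -/

section Canonical

variable {N : ℕ} {T : (Fin N → ℝ) → (Fin N → ℝ)} {a : Seminorm ℝ (Fin N → ℝ)}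

theorem exists_isFeasible (hT : IsInterferenceMapping T) (ha : IsMonotoneNorm a)
    {q : Fin N → ℝ} {c pbar : ℝ} (hc : 0 < c) (hq0 : 0 ≤ q) (hq : c • T q ≤ q)
    (hpbar : a q ≤ pbar) : ∃ p, IsFeasible T a pbar (p, c) := by
  obtain ⟨p, hp0, hpq, hp⟩ := hT.exists_fixed_le hc hq0 hq
  exact ⟨p, hp0, hc, hp, (ha.mono _ _ hp0 hpq).trans hpbar⟩

/-- If `0 < x < r` entrywise, some `c > 1` still satisfies `c x ≤ r`. -/
theorem exists_one_lt_smul_le {x r : Fin N → ℝ} (hx : ∀ i, 0 < x i) (hr : ∀ i, x i < r i) :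
    ∃ c : ℝ, 1 < c ∧ c • x ≤ r := by
  rcases Nat.eq_zero_or_pos N with rfl | hN
  · exact ⟨2, one_lt_two, fun i => i.elim0⟩
  obtain ⟨t, i, hti, htp⟩ := exists_max_ratio hN x fun i => (hx i).trans (hr i)
  have hri := (hx i).trans (hr i)
  have ht0 : 0 < t := pos_of_mul_pos_left (hti ▸ hx i) hri.le
  have ht1 : t < 1 := by
    by_contra! h
    nlinarith [hr i]
  refine ⟨t⁻¹, (one_lt_inv₀ ht0).2 ht1, fun j => ?_⟩
  have := htp j
  simp only [Pi.smul_apply, smul_eq_mul] at this ⊢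
  rwa [inv_mul_le_iff₀ ht0]

theorem exists_feasible (hN : 0 < N) (hT : IsInterferenceMapping T) (ha : IsMonotoneNorm a)
    {pbar : ℝ} (hpbar : 0 < pbar) : ∃ s, IsFeasible T a pbar s := by
  have ha1 : 0 < a 1 := ha.pos fun h => by simpa using congrFun h ⟨0, hN⟩
  have hq : ∀ i : Fin N, 0 < ((pbar / a 1) • (1 : Fin N → ℝ)) i := fun i => by
    simpa using div_pos hpbar ha1
  obtain ⟨t, i, hti, htq⟩ := exists_max_ratio hN (T ((pbar / a 1) • 1)) hq
  have hTpos := hT.pos _ (fun i => (hq i).le) i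
  have ht0 : 0 < t := pos_of_mul_pos_left (hti ▸ hTpos) (hq i).le
  obtain ⟨p, hp⟩ := exists_isFeasible (c := t⁻¹) (pbar := pbar) hT ha (inv_pos.2 ht0)
    (fun i => (hq i).le)
    (fun j => by
      have := htq j
      simp only [Pi.smul_apply, smul_eq_mul] at this ⊢
      rwa [inv_mul_le_iff₀ ht0])
    (by rw [map_smul_eq_mul, Real.norm_of_nonneg (div_pos hpbar ha1).le,
          div_mul_cancel₀ _ ha1.ne'])
  exact ⟨_, hp⟩

/-- The set of tuples of the canonical problem with `c = 0` added is compact. -/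
theorem isCompact_relaxed (hN : 0 < N) (hT : IsInterferenceMapping T) (ha : IsMonotoneNorm a)
    (pbar : ℝ) :
    IsCompact {s : (Fin N → ℝ) × ℝ | 0 ≤ s.1 ∧ 0 ≤ s.2 ∧ s.1 = s.2 • T s.1 ∧ a s.1 ≤ pbar} := by
  obtain ⟨C, hC, hCa⟩ := ha.abs_apply_le
  have hbox : IsCompact (Set.Icc (0 : Fin N → ℝ) (fun _ => C * pbar) ×ˢ
      Set.Icc (0 : ℝ) (C * pbar / T 0 ⟨0, hN⟩)) := isCompact_Icc.prod isCompact_Icc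
  have hdom : IsClosed (Set.Ici (0 : Fin N → ℝ) ×ˢ Set.Ici (0 : ℝ)) :=
    isClosed_Ici.prod isClosed_Ici
  have hcont : ContinuousOn (fun s : (Fin N → ℝ) × ℝ => s.1 - s.2 • T s.1)
      (Set.Ici (0 : Fin N → ℝ) ×ˢ Set.Ici (0 : ℝ)) :=
    continuousOn_fst.sub (continuousOn_snd.smul
      (hT.continuousOn.comp continuousOn_fst fun s hs => hs.1))
  have hclosed := (hcont.preimage_isClosed_of_isClosed hdom isClosed_singleton (t := {0})).inter
    (isClosed_le ((continuous_seminorm a).comp continuous_fst)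
      (continuous_const (y := pbar)))
  refine hbox.of_isClosed_subset (?_ : IsClosed _) ?_
  · convert hclosed using 1
    ext s
    simp only [Set.mem_ofPred_eq, Set.mem_inter_iff, Set.mem_prod, Set.mem_Ici, Set.mem_preimage,
      Set.mem_singleton_iff, sub_eq_zero, Function.comp_apply, and_assoc]
  · rintro ⟨p, c⟩ ⟨hp0, hc, hp, hap⟩
    have hpi : ∀ i, p i ≤ C * pbar := fun i =>
      (hCa p hp0 i).trans (mul_le_mul_of_nonneg_left hap hC.le)
    refine ⟨⟨hp0, hpi⟩, hc, ?_⟩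
    -- `c` is bounded because `c T(0) ≤ c T(p) = p`.
    have h0 := hT.pos 0 le_rfl ⟨0, hN⟩
    rw [le_div_iff₀ h0]
    have h1 : p ⟨0, hN⟩ = c * T p ⟨0, hN⟩ := congrFun hp _
    have h2 := mul_le_mul_of_nonneg_left (hT.mono le_rfl hp0 ⟨0, hN⟩) hc
    exact (h2.trans h1.ge).trans (hpi _)

theorem exists_isOptimal (hN : 0 < N) (hT : IsInterferenceMapping T) (ha : IsMonotoneNorm a)
    {pbar : ℝ} (hpbar : 0 < pbar) : ∃ s, IsOptimal T a pbar s := by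
  obtain ⟨s₀, hs₀⟩ := exists_feasible hN hT ha hpbar
  obtain ⟨s, ⟨h1, -, h3, h4⟩, hmax⟩ := (isCompact_relaxed hN hT ha pbar).exists_isMaxOn
    ⟨s₀, hs₀.nonneg, hs₀.pos.le, hs₀.fixed, hs₀.budget⟩ continuousOn_snd
  have hle : ∀ s', IsFeasible T a pbar s' → s'.2 ≤ s.2 := fun s' hs' =>
    hmax ⟨hs'.nonneg, hs'.pos.le, hs'.fixed, hs'.budget⟩
  exact ⟨s, ⟨h1, hs₀.pos.trans_le (hle s₀ hs₀), h3, h4⟩, hle⟩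

/-- A fixed point for the smaller utility is a subsolution for the larger one. -/
theorem IsFeasible.fst_le (hT : IsInterferenceMapping T) {r r' : ℝ}
    {s s' : (Fin N → ℝ) × ℝ} (hs : IsFeasible T a r s) (hs' : IsFeasible T a r' s')
    (h : s.2 ≤ s'.2) : s.1 ≤ s'.1 := by
  refine hT.le_of_subsolution hs'.pos hs.nonneg hs'.nonneg ?_ hs'.fixed.ge
  conv_lhs => rw [hs.fixed]
  exact smul_le_smul_of_nonneg_right h fun i => (hT.pos _ hs.nonneg i).le

theorem existsUnique_isOptimal (hN : 0 < N) (hT : IsInterferenceMapping T)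
    (ha : IsMonotoneNorm a) {pbar : ℝ} (hpbar : 0 < pbar) : ∃! s, IsOptimal T a pbar s := by
  obtain ⟨s, hs⟩ := exists_isOptimal hN hT ha hpbar
  refine ⟨s, hs, fun s' hs' => ?_⟩
  have h1 := hs.maximal _ hs'.feasible
  have h2 := hs'.maximal _ hs.feasible
  exact Prod.ext ((hs'.feasible.fst_le hT hs.feasible h1).antisymm
    (hs.feasible.fst_le hT hs'.feasible h2)) (h1.antisymm h2)

/-- The budget is exhausted at the optimum. -/
theorem IsOptimal.norm_eq (hT : IsInterferenceMapping T) (ha : IsMonotoneNorm a)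
    {pbar : ℝ} {s : (Fin N → ℝ) × ℝ} (hs : IsOptimal T a pbar s) : a s.1 = pbar := by
  refine hs.feasible.budget.eq_of_not_lt fun hlt => ?_
  have hcpos := hs.feasible.pos
  have h0 := hs.feasible.nonneg
  have ha0 := apply_nonneg a s.1
  -- Slack in the budget allows scaling the power by `t > 1`; the strict gap `T (t p) < t T p` then
  -- leaves room to raise the utility by a factor `k > 1`.
  obtain ⟨t, ht, hta⟩ : ∃ t : ℝ, 1 < t ∧ t * a s.1 ≤ pbar := by
    rcases ha0.eq_or_lt with h | h
    · exact ⟨2, one_lt_two, by rw [← h]; linarith⟩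
    · exact ⟨pbar / a s.1, (one_lt_div h).2 hlt, (div_mul_cancel₀ _ h.ne').le⟩
  have ht0 : 0 < t := one_pos.trans ht
  have hq0 : 0 ≤ t • s.1 := smul_nonneg ht0.le h0
  obtain ⟨k, hk, hkT⟩ := exists_one_lt_smul_le (hT.pos _ hq0) (hT.apply_smul_lt h0 ht)
  obtain ⟨p, hp⟩ := exists_isFeasible (c := s.2 * k) (q := t • s.1) (pbar := pbar) hT ha
    (mul_pos hcpos (one_pos.trans hk)) hq0
    (by
      calc (s.2 * k) • T (t • s.1) = s.2 • (k • T (t • s.1)) := mul_smul _ _ _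
        _ ≤ s.2 • (t • T s.1) := smul_le_smul_of_nonneg_left hkT hcpos.le
        _ = t • (s.2 • T s.1) := smul_comm _ _ _
        _ = t • s.1 := by rw [← hs.feasible.fixed])
    (by rwa [map_smul_eq_mul, Real.norm_of_nonneg ht0.le])
  have : s.2 * k ≤ s.2 := hs.maximal _ hp
  nlinarith

theorem isOptimal_solution (hN : 0 < N) (hT : IsInterferenceMapping T)
    (ha : IsMonotoneNorm a) {pbar : ℝ} (hpbar : 0 < pbar) :
    IsOptimal T a pbar (power T a pbar, utility T a pbar) :=
  Classical.epsilon_spec (exists_isOptimal hN hT ha hpbar)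

theorem power_mono (hN : 0 < N) (hT : IsInterferenceMapping T) (ha : IsMonotoneNorm a)
    {r r' : ℝ} (hr : 0 < r) (h : r ≤ r') : power T a r ≤ power T a r' := by
  have hs := isOptimal_solution hN hT ha hr
  have hs' := isOptimal_solution hN hT ha (hr.trans_le h)
  refine hs.feasible.fst_le hT hs'.feasible (hs'.maximal _ ?_)
  exact ⟨hs.feasible.nonneg, hs.feasible.pos, hs.feasible.fixed, hs.feasible.budget.trans h⟩

theorem energyEfficiency_eq (hN : 0 < N) (hT : IsInterferenceMapping T)
    (ha : IsMonotoneNorm a) (b : Seminorm ℝ (Fin N → ℝ)) {pbar : ℝ} (hpbar : 0 < pbar) :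
    energyEfficiency T a b pbar = 1 / b (T (power T a pbar)) := by
  have hs := (isOptimal_solution hN hT ha hpbar).feasible
  have hU : 0 < utility T a pbar := hs.pos
  have hfix : power T a pbar = utility T a pbar • T (power T a pbar) := hs.fixed
  have hb : b (power T a pbar) = utility T a pbar * b (T (power T a pbar)) := by
    conv_lhs => rw [hfix]
    rw [map_smul_eq_mul, Real.norm_of_nonneg hU.le]
  rw [energyEfficiency, hb, ← div_div, div_self hU.ne']

theorem norm_interference_pos (hN : 0 < N) (hT : IsInterferenceMapping T)
    {b : Seminorm ℝ (Fin N → ℝ)} (hb : IsMonotoneNorm b) {p : Fin N → ℝ} (hp : 0 ≤ p) :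
    0 < b (T p) :=
  hb.pos fun h => (hT.pos p hp ⟨0, hN⟩).ne' (congrFun h _)

theorem energyEfficiency_pos (hN : 0 < N) (hT : IsInterferenceMapping T)
    (ha : IsMonotoneNorm a) {b : Seminorm ℝ (Fin N → ℝ)} (hb : IsMonotoneNorm b)
    {pbar : ℝ} (hpbar : 0 < pbar) : 0 < energyEfficiency T a b pbar := by
  rw [energyEfficiency_eq hN hT ha b hpbar]
  exact one_div_pos.2
    (norm_interference_pos hN hT hb (isOptimal_solution hN hT ha hpbar).feasible.nonneg)

theorem energyEfficiency_anti (hN : 0 < N) (hT : IsInterferenceMapping T)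
    (ha : IsMonotoneNorm a) {b : Seminorm ℝ (Fin N → ℝ)} (hb : IsMonotoneNorm b)
    {r r' : ℝ} (hr : 0 < r) (h : r ≤ r') :
    energyEfficiency T a b r' ≤ energyEfficiency T a b r := by
  have hp : 0 ≤ power T a r := (isOptimal_solution hN hT ha hr).feasible.nonneg
  have hpp := power_mono hN hT ha hr h
  rw [energyEfficiency_eq hN hT ha b hr, energyEfficiency_eq hN hT ha b (hr.trans_le h)]
  exact one_div_le_one_div_of_le (norm_interference_pos hN hT hb hp)
    (hb.mono _ _ (fun i => (hT.pos _ hp i).le) (hT.mono hp hpp))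

theorem exists_tendsto_energyEfficiency_isGLB (hN : 0 < N) (hT : IsInterferenceMapping T)
    (ha : IsMonotoneNorm a) {b : Seminorm ℝ (Fin N → ℝ)} (hb : IsMonotoneNorm b) :
    ∃ L : ℝ, Tendsto (energyEfficiency T a b) atTop (𝓝 L) ∧
      IsGLB (energyEfficiency T a b '' Set.Ioi 0) L := by
  have hglb := isGLB_csInf (s := energyEfficiency T a b '' Set.Ioi 0)
    (Set.nonempty_Ioi.image _) ⟨0, by
      rintro _ ⟨r, hr, rfl⟩
      exact (energyEfficiency_pos hN hT ha hb hr).le⟩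
  refine ⟨_, tendsto_order.2 ⟨fun x hx => ?_, fun x hx => ?_⟩, hglb⟩
  · filter_upwards [eventually_gt_atTop 0] with r hr
    exact hx.trans_le (hglb.1 ⟨r, hr, rfl⟩)
  · obtain ⟨_, ⟨r, hr, rfl⟩, -, hrx⟩ := hglb.exists_between hx
    filter_upwards [eventually_ge_atTop r] with r' hr'
    exact (energyEfficiency_anti hN hT ha hb hr hr').trans_lt hrx

theorem one_div_affine_le_energyEfficiency (hN : 0 < N) (hT : IsInterferenceMapping T)
    (ha : IsMonotoneNorm a) {b : Seminorm ℝ (Fin N → ℝ)} (hb : IsMonotoneNorm b) :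
    ∃ k₁ k₂ : ℝ, 0 < k₁ ∧ 0 < k₂ ∧ ∀ pbar : ℝ, 0 < pbar →
      1 / (k₁ * pbar + k₂) ≤ energyEfficiency T a b pbar := by
  obtain ⟨C, hC, hCa⟩ := ha.abs_apply_le
  have hone : (0 : Fin N → ℝ) ≤ 1 := zero_le_one
  have hb1 : 0 < b (T 1) := norm_interference_pos hN hT hb hone
  refine ⟨C * b (T 1), b (T 1), mul_pos hC hb1, hb1, fun r hr => ?_⟩
  have hs := isOptimal_solution hN hT ha hr
  have hp : 0 ≤ power T a r := hs.feasible.nonneg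
  -- The `+ 1` keeps the factor at least `1`, as subhomogeneity requires.
  have hle : power T a r ≤ (C * r + 1) • (1 : Fin N → ℝ) := fun i => by
    have h1 := hCa _ hp i
    have h2 : a (power T a r) ≤ r := hs.feasible.budget
    have h3 := mul_le_mul_of_nonneg_left h2 hC.le
    simp only [Pi.smul_apply, Pi.one_apply, smul_eq_mul, mul_one]
    linarith
  have ht : 1 ≤ C * r + 1 := by linarith [mul_pos hC hr]
  have hTle : T (power T a r) ≤ (C * r + 1) • T 1 :=
    (hT.mono hp hle).trans (hT.apply_smul_le hone ht)
  have hble := hb.mono _ _ (fun i => (hT.pos _ hp i).le) hTle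
  rw [map_smul_eq_mul, Real.norm_of_nonneg (by linarith)] at hble
  rw [energyEfficiency_eq hN hT ha b hr]
  refine one_div_le_one_div_of_le (norm_interference_pos hN hT hb hp) (hble.trans_eq ?_)
  ring

end Canonical

/-! ### The lower bounding matrix and the `1 / pbar` rate -/

section LowerBoundingMatrix

variable {N : ℕ} {T : (Fin N → ℝ) → (Fin N → ℝ)}

/-- Subhomogeneity with factor `k / h`. The limit at `0⁺` is therefore an infimum, so it exists and
bounds every value from below. -/
theorem IsInterferenceMapping.monotoneOn_perspective (hT : IsInterferenceMapping T)
    {x : Fin N → ℝ} (hx : 0 ≤ x) (i : Fin N) :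
    MonotoneOn (fun h : ℝ => h * T (h⁻¹ • x) i) (Set.Ioi 0) := by
  intro h (hh : 0 < h) k (hk : 0 < k) hle
  have := hT.apply_smul_le (x := k⁻¹ • x) (smul_nonneg (inv_nonneg.2 hk.le) hx)
    ((one_le_div hh).2 hle) i
  rw [smul_smul, div_mul_eq_mul_div, mul_inv_cancel₀ hk.ne', one_div] at this
  simp only [Pi.smul_apply, smul_eq_mul] at this
  calc h * T (h⁻¹ • x) i ≤ h * (k / h * T (k⁻¹ • x) i) := mul_le_mul_of_nonneg_left this hh.le
    _ = k * T (k⁻¹ • x) i := by field_simp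

theorem single_nonneg (j : Fin N) : (0 : Fin N → ℝ) ≤ Pi.single j 1 :=
  Pi.single_nonneg.2 zero_le_one

theorem tendsto_lowerBoundingMatrix (hT : IsInterferenceMapping T) (i j : Fin N) :
    Tendsto (fun h : ℝ => h * T (h⁻¹ • Pi.single j (1 : ℝ)) i) (𝓝[>] 0)
      (𝓝 (lowerBoundingMatrix T i j)) := by
  refine tendsto_nhds_limUnder ⟨_, (hT.monotoneOn_perspective (single_nonneg j)
    i).tendsto_nhdsGT ⟨0, ?_⟩⟩
  rintro _ ⟨h, hh, rfl⟩
  have hh : 0 < h := hh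
  exact (mul_pos hh (hT.pos _ (smul_nonneg (inv_nonneg.2 hh.le) (single_nonneg j)) i)).le

theorem lowerBoundingMatrix_nonneg (hT : IsInterferenceMapping T) (i j : Fin N) :
    0 ≤ lowerBoundingMatrix T i j := by
  refine ge_of_tendsto (tendsto_lowerBoundingMatrix hT i j) ?_
  filter_upwards [self_mem_nhdsWithin] with h (hh : 0 < h)
  exact (mul_pos hh (hT.pos _ (smul_nonneg (inv_nonneg.2 hh.le) (single_nonneg j)) i)).le

theorem lowerBoundingMatrix_mul_le (hT : IsInterferenceMapping T) (i j : Fin N) {t : ℝ}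
    (ht : 0 ≤ t) : lowerBoundingMatrix T i j * t ≤ T (t • Pi.single j (1 : ℝ)) i := by
  rcases ht.eq_or_lt with rfl | ht
  · rw [mul_zero, zero_smul]
    exact (hT.pos 0 le_rfl i).le
  · have ht' : 0 < t⁻¹ := inv_pos.2 ht
    have h : lowerBoundingMatrix T i j ≤ t⁻¹ * T (t⁻¹⁻¹ • Pi.single j (1 : ℝ)) i := by
      refine le_of_tendsto (tendsto_lowerBoundingMatrix hT i j) ?_
      filter_upwards [Ioo_mem_nhdsGT ht'] with h hh
      exact hT.monotoneOn_perspective (single_nonneg j) i hh.1 ht' hh.2.le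
    rwa [inv_inv, ← div_eq_inv_mul, le_div_iff₀ ht] at h

/-- Jensen's inequality, with `p` written as the average of the `N` vectors `N p_j e_j`. -/
theorem lowerBoundingMatrix_mulVec_le (hN : 0 < N) (hT : IsInterferenceMapping T)
    {p : Fin N → ℝ} (hp : 0 ≤ p) : (lowerBoundingMatrix T).mulVec p ≤ T p := by
  have hN' : (0 : ℝ) < N := by exact_mod_cast hN
  have hconc := hT.concaveOn.le_map_sum (t := Finset.univ) (w := fun _ : Fin N => (N : ℝ)⁻¹)
    (p := fun j => (N * p j) • Pi.single j (1 : ℝ)) (fun _ _ => (inv_pos.2 hN').le)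
    (by simp [hN'.ne'])
    (fun j _ => Set.mem_Ici.2 (smul_nonneg (mul_nonneg hN'.le (hp j)) (single_nonneg j)))
  have hsum : ∑ j : Fin N, (N : ℝ)⁻¹ • (N * p j) • Pi.single j (1 : ℝ) = p := by
    ext k
    simp [Finset.sum_apply, Pi.single_apply, hN'.ne']
  rw [hsum] at hconc
  intro i
  refine le_trans ?_ (hconc i)
  rw [Finset.sum_apply, Matrix.mulVec, dotProduct]
  refine Finset.sum_le_sum fun j _ => ?_
  have := lowerBoundingMatrix_mul_le hT i j (mul_nonneg hN'.le (hp j))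
  rw [Pi.smul_apply, smul_eq_mul, ← div_eq_inv_mul, le_div_iff₀ hN']
  linarith

/-- A positive vector `p` with `M p ≤ r p` bounds the modulus of the eigenvalues of the
nonnegative matrix `M` by `r`. -/
theorem norm_eigenvalue_le (hN : 0 < N) {M : Matrix (Fin N) (Fin N) ℝ} (hM : ∀ i j, 0 ≤ M i j)
    {p : Fin N → ℝ} (hp : ∀ i, 0 < p i) {r : ℝ} (hr : M.mulVec p ≤ r • p)
    {v : Fin N → ℂ} (hv : v ≠ 0) {l : ℂ}
    (hl : (M.map (fun x : ℝ => (x : ℂ))).mulVec v = l • v) : ‖l‖ ≤ r := by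
  -- Row `i` of the eigenvalue equation, where `‖v i‖ / p i` is largest, gives `‖l‖ t p i ≤ t (M p)
  -- i ≤ r t p i`.
  obtain ⟨t, i, hti, htp⟩ := exists_max_ratio hN (fun i => ‖v i‖) hp
  have ht : 0 < t := by
    obtain ⟨k, hk⟩ := Function.ne_iff.1 hv
    have h1 : 0 < ‖v k‖ := norm_pos_iff.2 hk
    exact pos_of_mul_pos_left (h1.trans_le (htp k)) (hp k).le
  have h1 : ‖l‖ * ‖v i‖ ≤ ∑ j, M i j * ‖v j‖ := by
    rw [← norm_mul]
    have h2 : l * v i = ∑ j, (M i j : ℂ) * v j := by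
      have := congrFun hl i
      simpa [Matrix.mulVec, dotProduct] using this.symm
    rw [h2]
    refine (norm_sum_le _ _).trans_eq (Finset.sum_congr rfl fun j _ => ?_)
    rw [norm_mul, Complex.norm_real, Real.norm_of_nonneg (hM i j)]
  have h2 : ∑ j, M i j * ‖v j‖ ≤ t * M.mulVec p i := by
    rw [Matrix.mulVec, dotProduct, Finset.mul_sum]
    refine Finset.sum_le_sum fun j _ => ?_
    have h3 := mul_le_mul_of_nonneg_left (htp j) (hM i j)
    simp only [Pi.smul_apply, smul_eq_mul] at h3
    linarith
  have h3 : t * M.mulVec p i ≤ t * (r * p i) := mul_le_mul_of_nonneg_left (hr i) ht.le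
  have h4 : ‖v i‖ = t * p i := hti
  rw [h4] at h1
  have h5 : 0 < t * p i := mul_pos ht (hp i)
  have h6 : ‖l‖ * (t * p i) ≤ r * (t * p i) := by linarith
  exact le_of_mul_le_mul_right h6 h5

theorem exists_eigenvector_of_rho_pos {M : Matrix (Fin N) (Fin N) ℝ} (hM : 0 < rho M) :
    ∃ (l : ℂ) (v : Fin N → ℂ), l ≠ 0 ∧ v ≠ 0 ∧
      (M.map (fun x : ℝ => (x : ℂ))).mulVec v = l • v := by
  rw [rho, spectralRadius] at hM
  simp only [lt_iSup_iff] at hM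
  obtain ⟨l, hl, hpos⟩ := hM
  have hl0 : l ≠ 0 := by
    rintro rfl
    simp at hpos
  rw [← Matrix.spectrum_toLin', ← Module.End.hasEigenvalue_iff_mem_spectrum] at hl
  obtain ⟨v, hv⟩ := hl.exists_hasEigenvector
  exact ⟨l, v, hl0, hv.2, by simpa using hv.apply_eq_smul⟩

/-- The utility is bounded if the spectral radius of the lower bounding matrix is positive. -/
theorem exists_utility_le (hN : 0 < N) (hT : IsInterferenceMapping T)
    {a : Seminorm ℝ (Fin N → ℝ)} (ha : IsMonotoneNorm a)
    (hrho : 0 < rho (lowerBoundingMatrix T)) :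
    ∃ K : ℝ, 0 < K ∧ ∀ pbar : ℝ, 0 < pbar → utility T a pbar ≤ K := by
  obtain ⟨l, v, hl, hv, hlv⟩ := exists_eigenvector_of_rho_pos hrho
  have hl' : 0 < ‖l‖ := norm_pos_iff.2 hl
  refine ⟨‖l‖⁻¹, inv_pos.2 hl', fun r hr => ?_⟩
  have hs := (isOptimal_solution hN hT ha hr).feasible
  have hU : 0 < utility T a r := hs.pos
  have hp : 0 ≤ power T a r := hs.nonneg
  have hfix : power T a r = utility T a r • T (power T a r) := hs.fixed
  have hpos : ∀ i, 0 < power T a r i := fun i => by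
    rw [hfix]
    exact mul_pos hU (hT.pos _ hp i)
  have hTp : T (power T a r) = (utility T a r)⁻¹ • power T a r := by
    conv_rhs => rw [hfix]
    rw [smul_smul, inv_mul_cancel₀ hU.ne', one_smul]
  have := norm_eigenvalue_le hN (lowerBoundingMatrix_nonneg hT) hpos
    ((lowerBoundingMatrix_mulVec_le hN hT hp).trans_eq hTp) hv hlv
  rwa [le_inv_comm₀ hl' hU] at this

theorem scalesAsTheta_energyEfficiency (hN : 0 < N) (hT : IsInterferenceMapping T)
    {a b : Seminorm ℝ (Fin N → ℝ)} (ha : IsMonotoneNorm a) (hb : IsMonotoneNorm b)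
    (hrho : 0 < rho (lowerBoundingMatrix T)) :
    ScalesAsTheta (energyEfficiency T a b) (fun x => 1 / x) := by
  obtain ⟨k₁, k₂, hk₁, hk₂, hlow⟩ := one_div_affine_le_energyEfficiency hN hT ha hb
  obtain ⟨K, hK, hUK⟩ := exists_utility_le hN hT ha hrho
  obtain ⟨C, hC, hCab⟩ := ha.le_mul hb
  -- For `r ≥ 1`, `k₁ r + k₂ ≤ (k₁ + k₂) r`; the upper constant combines `U ≤ K` with `r = ‖P‖_a ≤ C
  -- ‖P‖_b`.
  refine ⟨1, (k₁ + k₂)⁻¹, K * C, one_pos, inv_pos.2 (add_pos hk₁ hk₂), mul_pos hK hC,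
    fun r hr => ?_⟩
  have hr0 : 0 < r := one_pos.trans_le hr
  have hs := isOptimal_solution hN hT ha hr0
  constructor
  · refine le_trans ?_ (hlow r hr0)
    rw [inv_mul_eq_div, div_div]
    refine one_div_le_one_div_of_le (by positivity) ?_
    nlinarith
  · have har : r ≤ C * b (power T a r) :=
      (hs.norm_eq hT ha).ge.trans (hCab _ hs.feasible.nonneg)
    have hbpos : 0 < b (power T a r) := pos_of_mul_pos_right (hr0.trans_le har) hC.le
    have hU := hUK r hr0
    rw [energyEfficiency, mul_one_div, div_le_div_iff₀ hbpos hr0]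
    calc utility T a r * r ≤ K * (C * b (power T a r)) :=
          mul_le_mul hU har hr0.le hK.le
      _ = K * C * b (power T a r) := by ring

theorem tendsto_energyEfficiency_zero (hN : 0 < N) (hT : IsInterferenceMapping T)
    {a b : Seminorm ℝ (Fin N → ℝ)} (ha : IsMonotoneNorm a) (hb : IsMonotoneNorm b)
    (hrho : 0 < rho (lowerBoundingMatrix T)) :
    Tendsto (energyEfficiency T a b) atTop (𝓝 0) := by
  obtain ⟨k₀, k₁, k₂, hk₀, -, -, h⟩ := scalesAsTheta_energyEfficiency hN hT ha hb hrho
  have hlim : Tendsto (fun x : ℝ => k₂ * (1 / x)) atTop (𝓝 0) := by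
    simpa using tendsto_inv_atTop_zero.const_mul k₂
  refine tendsto_of_tendsto_of_tendsto_of_le_of_le' tendsto_const_nhds hlim ?_ ?_
  · filter_upwards [eventually_gt_atTop 0] with r hr
    exact (energyEfficiency_pos hN hT ha hb hr).le
  · filter_upwards [eventually_ge_atTop k₀] with r hr
    exact (h r hr).2

end LowerBoundingMatrix

end NetUtility

theorem mainTheorem4 (N : ℕ) (hN : 0 < N)
    (T : (Fin N → ℝ) → (Fin N → ℝ)) (hT : NetUtility.IsInterferenceMapping T)
    (a b : Seminorm ℝ (Fin N → ℝ))
    (ha : NetUtility.IsMonotoneNorm a) (hb : NetUtility.IsMonotoneNorm b) :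
    -- the solution of the canonical problem, hence `E`, is well defined
    (∀ pbar : ℝ, 0 < pbar → ∃! s, NetUtility.IsOptimal T a pbar s) ∧
    -- the limits defining the lower bounding matrix exist and are nonnegative
    (∀ i j, Tendsto (fun h : ℝ => h * T (h⁻¹ • Pi.single j (1 : ℝ)) i) (𝓝[>] 0)
        (𝓝 (NetUtility.lowerBoundingMatrix T i j)) ∧
      0 ≤ NetUtility.lowerBoundingMatrix T i j) ∧
    -- (i)
    (∃ L : ℝ, Tendsto (NetUtility.energyEfficiency T a b) atTop (𝓝 L) ∧
      IsGLB (NetUtility.energyEfficiency T a b '' Set.Ioi 0) L) ∧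
    (0 < NetUtility.rho (NetUtility.lowerBoundingMatrix T) →
      Tendsto (NetUtility.energyEfficiency T a b) atTop (𝓝 0)) ∧
    -- (ii)
    (0 < NetUtility.rho (NetUtility.lowerBoundingMatrix T) →
      ∃ k₁ k₂ : ℝ, 0 < k₁ ∧ 0 < k₂ ∧ ∀ pbar : ℝ, 0 < pbar →
        1 / (k₁ * pbar + k₂) ≤ NetUtility.energyEfficiency T a b pbar) ∧
    -- (iii)
    (0 < NetUtility.rho (NetUtility.lowerBoundingMatrix T) →
      NetUtility.ScalesAsTheta (NetUtility.energyEfficiency T a b) (fun x => 1 / x)) := by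
  exact ⟨fun _ hr => NetUtility.existsUnique_isOptimal hN hT ha hr,
    fun i j => ⟨NetUtility.tendsto_lowerBoundingMatrix hT i j,
      NetUtility.lowerBoundingMatrix_nonneg hT i j⟩,
    NetUtility.exists_tendsto_energyEfficiency_isGLB hN hT ha hb,
    NetUtility.tendsto_energyEfficiency_zero hN hT ha hb,
    fun _ => NetUtility.one_div_affine_le_energyEfficiency hN hT ha hb,
    NetUtility.scalesAsTheta_energyEfficiency hN hT ha hb⟩
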